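/- Let $k$ be a field of characteristic $0$ with an ultrametric absolute value $|\cdot|$, complete with respect to the associated ultrametric $d(x,y)=|x-y|$. For $r>0$ write $B(0,r)=\{x\in k:|x|<r\}$ and $\overline B(0,r)=\{x\in k:|x|\le r\}$, and put $$f(x)=\log(1+x)=\sum_{j=1}^\infty\frac{(-1)^{j+1}}{j}\,x^j$$ for $x\in k$ with $|x|<1$. (A) Suppose that the absolute value induced on $\mathbf Q\subseteq k$ is trivial. Then the series converges in $k$ for every $x\in k$ with $|x|<1$, and 1. $|\log(1+x)|=|x|$ for all $x\in k$ with $|x|<1$; 2. $|\log(1+y)-\log(1+z)|=|y-z|$ for all $y,z\in k$ with $|y|,|z|<1$; 3. $f(\overline B(0,t))=\overline B(0,t)$ for every real $t$ with $0<t<1$, and $f(B(0,1))=B(0,1)$. (B) Let $p$ be a prime number, suppose that the absolute value induced on $\mathbf Q\subseteq k$ is the $p$-adic absolute value (normalized by $|p|_p=1/p$), and put $r_p=p^{-1/(p-1)}$. Then the series converges in $k$ for every $x\in k$ with $|x|<1$, and 1. $|\log(1+x)|\le|x|$ for all $x\in k$ with $|x|\le r_p$; 2. $|\log(1+y)-\log(1+z)|\le|y-z|$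 for all $y,z\in k$ with $|y|,|z|<1$ and $|(1+y)/(1+z)-1|\le r_p$, and in particular for all $y,z\in k$ with $|y|,|z|\le r_p$; 3. $|\log(1+x)|=|x|$ for all $x\in k$ with $|x|<r_p$; 4. $|\log(1+y)-\log(1+z)|=|y-z|$ for all $y,z\in k$ with $|y|,|z|<1$ and $|(1+y)/(1+z)-1|<r_p$, and in particular for all $y,z\in k$ with $|y|,|z|<r_p$; 5. $f(\overline B(0,t))=\overline B(0,t)$ for every real $t$ with $0<t<r_p$, and $f(B(0,r_p))=B(0,r_p)$. -/

import Mathlib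

namespace UltrametricLog

/-- The logarithm on a normed field, given by the power series
`log w = ∑_{j ≥ 1} (-1)^(j+1) / j * (w - 1)^j`.
The sum is indexed here by `j + 1` with `j : ℕ`. In a complete ultrametric field, convergence of
the partial sums and summability are the same for such a series. -/
noncomputable def log {k : Type*} [NormedField k] (w : k) : k :=
  ∑' j : ℕ, (-1 : k) ^ (j + 2) / ((j + 1 : ℕ) : k) * (w - 1) ^ (j + 1)

/-- The induced absolute value on `ℚ` is trivial. -/
def InducesTrivial (k : Type*) [NormedField k] : Prop :=
  ∀ q : ℚ, q ≠ 0 → ‖(q : k)‖ = 1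

/-- The induced absolute value on `ℚ` is the `p`-adic absolute value. -/
def InducesPadic (k : Type*) [NormedField k] (p : ℕ) : Prop :=
  ∀ q : ℚ, ‖(q : k)‖ = ((padicNorm p q : ℚ) : ℝ)

/-- The radius `p ^ (-1 / (p - 1))`. -/
noncomputable def radius (p : ℕ) : ℝ :=
  (p : ℝ) ^ (-(1 : ℝ) / ((p : ℝ) - 1))

end UltrametricLog

/-!
The theorem rests on two observations about `log (1 + x) = x - x²/2 + x³/3 - …`.

The series converges on the open unit ball because `‖j + 1‖⁻¹ ≤ j + 1` for all `j`, in the trivial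
as in the `p`-adic case; this bound is the hypothesis `hinv` of the lemmas below.

*The linear term dominates on small balls.* Suppose that `ρ ^ j ≤ ‖j + 1‖` for all `j`. If
`‖y‖, ‖z‖ ≤ t`, then `‖y ^ (j + 1) - z ^ (j + 1)‖ ≤ t ^ j ‖y - z‖`, so the `j`-th term of
`log (1 + y) - log (1 + z)` has norm at most `(t / ρ) ^ j ‖y - z‖`. Hence `x ↦ log (1 + x)` is
`1`-Lipschitz on the closed ball of radius `ρ`, and for `t < ρ` the function `log (1 + x) - x` is
a contraction on the closed ball of radius `t` (`norm_log_sub_id_sub_le`). The ultrametric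
inequality then makes `x ↦ log (1 + x)` an isometry there (`norm_log_sub_eq`), and Banach's fixed
point theorem for `x ↦ w - (log (1 + x) - x)` makes it surjective (`image_closedBall_log`). For a
trivial absolute value on `ℚ` one takes `ρ = 1`; for the `p`-adic one `ρ = p ^ (-1 / (p - 1))`,
where the hypothesis reads `(p - 1) v_p(j + 1) ≤ j` and follows from Bernoulli's inequality
(`radius_pow_le`).

*The functional equation.* The estimates for `‖y‖, ‖z‖ < 1` in the `p`-adic case need
`log (a b) = log a + log b`. It follows from the formula `log a = lim (a ^ N - 1) / N` as `N → 0`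
in `k` through positive integers (`tendsto_pow_sub_one_div`), which is applied to `N = p ^ n`.
This formula is a dominated convergence statement: the coefficient of `x ^ (j + 1)` in
`((1 + x) ^ N - 1) / N` is `(N - 1).choose j / (j + 1)`, and `(N - 1).choose j` tends to
`(-1) ^ j`.
-/

namespace UltrametricLog

open Filter Topology

variable {k : Type*} [NormedField k]

/-! ### Convergence of the series -/

theorem log_one_add (x : k) :
    log (1 + x) = ∑' j : ℕ, (-1 : k) ^ (j + 2) / ((j + 1 : ℕ) : k) * x ^ (j + 1) := by
  simp [log]

theorem summable_succ_mul_pow {r : ℝ} (h0 : 0 ≤ r) (h1 : r < 1) :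
    Summable fun j : ℕ => ((j : ℝ) + 1) * r ^ (j + 1) := by
  have h := (summable_nat_add_iff 1).2
    (summable_pow_mul_geometric_of_norm_lt_one 1 (r := r) (by rwa [Real.norm_of_nonneg h0]))
  simpa using h

theorem hasSum_log [CompleteSpace k] (hinv : ∀ j : ℕ, ‖((j + 1 : ℕ) : k)‖⁻¹ ≤ j + 1) {x : k}
    (hx : ‖x‖ < 1) :
    HasSum (fun j : ℕ => (-1 : k) ^ (j + 2) / ((j + 1 : ℕ) : k) * x ^ (j + 1))
      (log (1 + x)) := by
  rw [log_one_add]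
  refine (Summable.of_norm_bounded (summable_succ_mul_pow (norm_nonneg x) hx)
    fun j => ?_).hasSum
  rw [norm_mul, norm_div, norm_pow, norm_pow, norm_neg, norm_one, one_pow, one_div]
  exact mul_le_mul_of_nonneg_right (hinv j) (by positivity)

@[simp]
theorem log_one : log (1 : k) = 0 := by
  simp [log]

/-! ### Estimates on small balls -/

section Estimates

variable [IsUltrametricDist k]

theorem norm_pow_succ_sub_pow_succ_le {y z : k} {t : ℝ} (hy : ‖y‖ ≤ t) (hz : ‖z‖ ≤ t) (j : ℕ) :
    ‖y ^ (j + 1) - z ^ (j + 1)‖ ≤ t ^ j * ‖y - z‖ := by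
  have ht : 0 ≤ t := (norm_nonneg y).trans hy
  rw [← geom_sum₂_mul, norm_mul]
  refine mul_le_mul_of_nonneg_right ?_ (norm_nonneg _)
  refine IsUltrametricDist.norm_sum_le_of_forall_le_of_nonneg (by positivity) fun i hi => ?_
  rw [norm_mul, norm_pow, norm_pow]
  have hij : i + (j + 1 - 1 - i) = j := by
    have := Finset.mem_range.1 hi
    omega
  calc ‖y‖ ^ i * ‖z‖ ^ (j + 1 - 1 - i) ≤ t ^ i * t ^ (j + 1 - 1 - i) := by gcongr
    _ = t ^ j := by rw [← pow_add, hij]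

variable {ρ t : ℝ}

theorem norm_log_term_sub_le (hρ : 0 < ρ) (hpow : ∀ j : ℕ, ρ ^ j ≤ ‖((j + 1 : ℕ) : k)‖) {y z : k}
    (hy : ‖y‖ ≤ t) (hz : ‖z‖ ≤ t) (j : ℕ) :
    ‖(-1 : k) ^ (j + 2) / ((j + 1 : ℕ) : k) * y ^ (j + 1)
      - (-1 : k) ^ (j + 2) / ((j + 1 : ℕ) : k) * z ^ (j + 1)‖ ≤ (t / ρ) ^ j * ‖y - z‖ := by
  have ht : 0 ≤ t := (norm_nonneg y).trans hy
  rw [← mul_sub, norm_mul, norm_div, norm_pow, norm_neg, norm_one, one_pow]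
  calc 1 / ‖((j + 1 : ℕ) : k)‖ * ‖y ^ (j + 1) - z ^ (j + 1)‖
      ≤ 1 / ρ ^ j * (t ^ j * ‖y - z‖) := by
        gcongr
        · exact hpow j
        · exact norm_pow_succ_sub_pow_succ_le hy hz j
    _ = (t / ρ) ^ j * ‖y - z‖ := by rw [div_pow]; ring

variable [CompleteSpace k]

theorem norm_log_sub_le (hinv : ∀ j : ℕ, ‖((j + 1 : ℕ) : k)‖⁻¹ ≤ j + 1) (hρ : 0 < ρ)
    (hpow : ∀ j : ℕ, ρ ^ j ≤ ‖((j + 1 : ℕ) : k)‖) {y z : k}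
    (hy : ‖y‖ ≤ ρ) (hz : ‖z‖ ≤ ρ) (hy1 : ‖y‖ < 1) (hz1 : ‖z‖ < 1) :
    ‖log (1 + y) - log (1 + z)‖ ≤ ‖y - z‖ := by
  rw [← ((hasSum_log hinv hy1).sub (hasSum_log hinv hz1)).tsum_eq]
  refine IsUltrametricDist.norm_tsum_le_of_forall_le fun j => ?_
  simpa [div_self hρ.ne'] using norm_log_term_sub_le hρ hpow hy hz j

/-- On a closed ball of radius `t < ρ` the function `log (1 + x) - x` is a contraction with
constant `t / ρ`. -/
theorem norm_log_sub_id_sub_le (hinv : ∀ j : ℕ, ‖((j + 1 : ℕ) : k)‖⁻¹ ≤ j + 1) (hρ : 0 < ρ)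
    (hpow : ∀ j : ℕ, ρ ^ j ≤ ‖((j + 1 : ℕ) : k)‖) (htρ : t < ρ) (ht1 : t < 1) {y z : k}
    (hy : ‖y‖ ≤ t) (hz : ‖z‖ ≤ t) :
    ‖(log (1 + y) - y) - (log (1 + z) - z)‖ ≤ t / ρ * ‖y - z‖ := by
  have ht : 0 ≤ t := (norm_nonneg y).trans hy
  have hs := (hasSum_log hinv (hy.trans_lt ht1)).sub (hasSum_log hinv (hz.trans_lt ht1))
  -- Dropping the term of index `0`, which is `y - z`, leaves the terms of order at least two.
  have hs' := (hasSum_nat_add_iff' 1).2 hs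
  have he : (log (1 + y) - y) - (log (1 + z) - z) = (log (1 + y) - log (1 + z)) -
      ∑ j ∈ Finset.range 1, ((-1 : k) ^ (j + 2) / ((j + 1 : ℕ) : k) * y ^ (j + 1)
        - (-1 : k) ^ (j + 2) / ((j + 1 : ℕ) : k) * z ^ (j + 1)) := by
    simp
    ring
  rw [he, ← hs'.tsum_eq]
  refine IsUltrametricDist.norm_tsum_le_of_forall_le fun j => ?_
  refine (norm_log_term_sub_le hρ hpow hy hz (j + 1)).trans ?_
  gcongr
  exact pow_le_of_le_one (by positivity) ((div_le_one hρ).2 htρ.le) (by omega)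

theorem norm_log_sub_eq (hinv : ∀ j : ℕ, ‖((j + 1 : ℕ) : k)‖⁻¹ ≤ j + 1) (hρ : 0 < ρ)
    (hρ1 : ρ ≤ 1) (hpow : ∀ j : ℕ, ρ ^ j ≤ ‖((j + 1 : ℕ) : k)‖) {y z : k}
    (hy : ‖y‖ < ρ) (hz : ‖z‖ < ρ) :
    ‖log (1 + y) - log (1 + z)‖ = ‖y - z‖ := by
  rcases eq_or_ne y z with rfl | hne
  · simp
  have hpos : 0 < ‖y - z‖ := norm_pos_iff.2 (sub_ne_zero.2 hne)
  have ht : max ‖y‖ ‖z‖ < ρ := max_lt hy hz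
  have h := norm_log_sub_id_sub_le hinv hρ hpow ht (ht.trans_le hρ1) (le_max_left _ _)
    (le_max_right _ _)
  have hlt : ‖(log (1 + y) - log (1 + z)) + -(y - z)‖ < ‖-(y - z)‖ := by
    rw [norm_neg]
    calc _ = ‖(log (1 + y) - y) - (log (1 + z) - z)‖ := by congr 1; ring
      _ ≤ _ := h
      _ < 1 * ‖y - z‖ := mul_lt_mul_of_pos_right ((div_lt_one hρ).2 ht) hpos
      _ = ‖y - z‖ := one_mul _
  rw [← norm_neg (y - z)]
  exact IsUltrametricDist.norm_eq_of_add_norm_lt_max (hlt.trans_le (le_max_right _ _))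

theorem norm_log_eq (hinv : ∀ j : ℕ, ‖((j + 1 : ℕ) : k)‖⁻¹ ≤ j + 1) (hρ : 0 < ρ) (hρ1 : ρ ≤ 1)
    (hpow : ∀ j : ℕ, ρ ^ j ≤ ‖((j + 1 : ℕ) : k)‖) {x : k} (hx : ‖x‖ < ρ) :
    ‖log (1 + x)‖ = ‖x‖ := by
  simpa using norm_log_sub_eq hinv hρ hρ1 hpow hx (z := 0) (by simpa)

/-! ### Images of balls -/

theorem image_closedBall_log (hinv : ∀ j : ℕ, ‖((j + 1 : ℕ) : k)‖⁻¹ ≤ j + 1) (hρ : 0 < ρ)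
    (hρ1 : ρ ≤ 1) (hpow : ∀ j : ℕ, ρ ^ j ≤ ‖((j + 1 : ℕ) : k)‖) (ht : 0 ≤ t) (htρ : t < ρ) :
    (fun x : k => log (1 + x)) '' Metric.closedBall 0 t = Metric.closedBall 0 t := by
  have ht1 : t < 1 := htρ.trans_le hρ1
  apply Set.Subset.antisymm
  · rintro _ ⟨x, hx, rfl⟩
    rw [mem_closedBall_zero_iff] at hx ⊢
    exact (norm_log_eq hinv hρ hρ1 hpow (hx.trans_lt htρ)).trans_le hx
  intro w hw
  -- A fixed point of `F` is a solution of `log (1 + x) = w`.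
  let F : k → k := fun x => w - (log (1 + x) - x)
  have hF : Set.MapsTo F (Metric.closedBall 0 t) (Metric.closedBall 0 t) := by
    intro x hx
    rw [mem_closedBall_zero_iff] at *
    have hlog := (norm_log_eq hinv hρ hρ1 hpow (hx.trans_lt htρ)).trans_le hx
    have hsub {a b : k} (ha : ‖a‖ ≤ t) (hb : ‖b‖ ≤ t) : ‖a - b‖ ≤ t := by
      rw [sub_eq_add_neg]
      exact (IsUltrametricDist.norm_add_le_max _ _).trans (max_le ha (by rwa [norm_neg]))
    exact hsub hw (hsub hlog hx)
  have hcontr : ContractingWith ⟨t / ρ, div_nonneg ht hρ.le⟩ (hF.restrict F _ _) := by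
    refine ⟨(div_lt_one hρ).2 htρ, LipschitzWith.of_dist_le_mul fun y z => ?_⟩
    have h := norm_log_sub_id_sub_le hinv hρ hpow htρ ht1 (mem_closedBall_zero_iff.1 y.2)
      (mem_closedBall_zero_iff.1 z.2)
    rw [Subtype.dist_eq, Subtype.dist_eq, dist_eq_norm, dist_eq_norm, Set.MapsTo.val_restrict_apply,
      Set.MapsTo.val_restrict_apply]
    simp only [F, sub_sub_sub_cancel_left]
    rw [norm_sub_rev]
    exact h
  obtain ⟨x, hx, hfix, -⟩ := hcontr.exists_fixedPoint' Metric.isClosed_closedBall.isComplete hF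
    (Metric.mem_closedBall_self ht) (edist_ne_top _ _)
  refine ⟨x, hx, ?_⟩
  have : w - (log (1 + x) - x) = x := hfix
  linear_combination -this

theorem image_ball_log (hinv : ∀ j : ℕ, ‖((j + 1 : ℕ) : k)‖⁻¹ ≤ j + 1) (hρ : 0 < ρ)
    (hρ1 : ρ ≤ 1) (hpow : ∀ j : ℕ, ρ ^ j ≤ ‖((j + 1 : ℕ) : k)‖) :
    (fun x : k => log (1 + x)) '' Metric.ball 0 ρ = Metric.ball 0 ρ := by
  apply Set.Subset.antisymm
  · rintro _ ⟨x, hx, rfl⟩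
    rw [mem_ball_zero_iff] at hx ⊢
    exact (norm_log_eq hinv hρ hρ1 hpow hx).trans_lt hx
  intro w hw
  rw [mem_ball_zero_iff] at hw
  have hmem : w ∈ (fun x : k => log (1 + x)) '' Metric.closedBall 0 ‖w‖ := by
    rw [image_closedBall_log hinv hρ hρ1 hpow (norm_nonneg w) hw]
    simp
  obtain ⟨x, hx, rfl⟩ := hmem
  exact ⟨x, Metric.closedBall_subset_ball hw hx, rfl⟩

end Estimates

/-! ### The functional equation -/

section FunctionalEquation

variable [CharZero k]

theorem pow_succ_sub_one_div_eq_tsum (x : k) (m : ℕ) :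
    ((1 + x) ^ (m + 1) - 1) / ((m + 1 : ℕ) : k)
      = ∑' j : ℕ, (m.choose j : k) / ((j + 1 : ℕ) : k) * x ^ (j + 1) := by
  rw [tsum_eq_sum (s := Finset.range (m + 1))]
  · have hm : ((m + 1 : ℕ) : k) ≠ 0 := Nat.cast_ne_zero.2 m.succ_ne_zero
    rw [div_eq_iff hm, add_comm 1 x, add_pow, Finset.sum_range_succ', Finset.sum_mul]
    simp only [one_pow, mul_one, pow_zero, Nat.choose_zero_right, Nat.cast_one,
      add_sub_cancel_right]
    refine Finset.sum_congr rfl fun j _ => ?_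
    have hj : ((j + 1 : ℕ) : k) ≠ 0 := Nat.cast_ne_zero.2 j.succ_ne_zero
    have h : ((m + 1 : ℕ) : k) * (m.choose j : k)
        = ((m + 1).choose (j + 1) : k) * ((j + 1 : ℕ) : k) := by
      exact_mod_cast Nat.add_one_mul_choose_eq m j
    rw [div_mul_eq_mul_div, div_mul_eq_mul_div, eq_div_iff hj]
    linear_combination -(x ^ (j + 1)) * h
  · intro j hj
    rw [Nat.choose_eq_zero_of_lt (Nat.lt_of_succ_le (not_lt.1 (mt Finset.mem_range.2 hj)))]
    simp

variable {ι : Type*} {l : Filter ι} {m : ι → ℕ}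

/-- The binomial coefficients `m.choose j` tend to `(-1).choose j = (-1) ^ j` as `m → -1`. -/
theorem tendsto_choose_of_tendsto_succ (hm : Tendsto (fun i => ((m i + 1 : ℕ) : k)) l (𝓝 0))
    (j : ℕ) : Tendsto (fun i => ((m i).choose j : k)) l (𝓝 ((-1) ^ j)) := by
  induction j with
  | zero => simp [tendsto_const_nhds]
  | succ j ih =>
    have hj : ((j + 1 : ℕ) : k) ≠ 0 := Nat.cast_ne_zero.2 j.succ_ne_zero
    have h := ((hm.mul ih).div_const ((j + 1 : ℕ) : k)).sub ih
    have hlim : 0 * (-1 : k) ^ j / ((j + 1 : ℕ) : k) - (-1) ^ j = (-1) ^ (j + 1) := by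
      rw [pow_succ]
      ring
    rw [hlim] at h
    refine h.congr fun i => ?_
    have h1 : ((m i + 1 : ℕ) : k) * ((m i).choose j : k)
        = (((m i).choose j : k) + ((m i).choose (j + 1) : k)) * ((j + 1 : ℕ) : k) := by
      exact_mod_cast Nat.choose_succ_succ (m i) j ▸ Nat.add_one_mul_choose_eq (m i) j
    rw [h1, mul_div_cancel_right₀ _ hj]
    ring

variable [IsUltrametricDist k] [CompleteSpace k]

/-- The formula `log a = lim (a ^ N - 1) / N` as the positive integers `N = m i + 1` tend to `0`
in `k`. -/
theorem tendsto_pow_sub_one_div (hinv : ∀ j : ℕ, ‖((j + 1 : ℕ) : k)‖⁻¹ ≤ j + 1)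
    (hm : Tendsto (fun i => ((m i + 1 : ℕ) : k)) l (𝓝 0)) {x : k} (hx : ‖x‖ < 1) :
    Tendsto (fun i => ((1 + x) ^ (m i + 1) - 1) / ((m i + 1 : ℕ) : k)) l
      (𝓝 (log (1 + x))) := by
  simp only [pow_succ_sub_one_div_eq_tsum, log_one_add]
  refine tendsto_tsum_of_dominated_convergence (summable_succ_mul_pow (norm_nonneg x) hx)
    (fun j => ?_) (Eventually.of_forall fun i j => ?_)
  · have h := tendsto_choose_of_tendsto_succ hm j
    have hj : (-1 : k) ^ (j + 2) = (-1) ^ j := by rw [pow_add]; simp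
    rw [hj]
    exact (h.div_const _).mul_const _
  · rw [norm_mul, norm_div, norm_pow]
    refine mul_le_mul_of_nonneg_right (le_trans ?_ (hinv j)) (by positivity)
    rw [← one_div]
    gcongr
    exact IsUltrametricDist.norm_natCast_le_one k _

theorem log_mul [l.NeBot] (hinv : ∀ j : ℕ, ‖((j + 1 : ℕ) : k)‖⁻¹ ≤ j + 1)
    (hm : Tendsto (fun i => ((m i + 1 : ℕ) : k)) l (𝓝 0)) {a b : k}
    (ha : ‖a - 1‖ < 1) (hb : ‖b - 1‖ < 1) : log (a * b) = log a + log b := by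
  have hab : ‖a * b - 1‖ < 1 := by
    have h : a * b - 1 = (a - 1) * (b - 1) + ((a - 1) + (b - 1)) := by ring
    rw [h]
    refine (IsUltrametricDist.norm_add_le_max _ _).trans_lt (max_lt ?_ ?_)
    · rw [norm_mul]
      exact mul_lt_one_of_nonneg_of_lt_one_left (norm_nonneg _) ha hb.le
    · exact (IsUltrametricDist.norm_add_le_max _ _).trans_lt (max_lt ha hb)
  have hlim {c : k} (hc : ‖c - 1‖ < 1) :
      Tendsto (fun i => (c ^ (m i + 1) - 1) / ((m i + 1 : ℕ) : k)) l (𝓝 (log c)) := by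
    simpa using tendsto_pow_sub_one_div hinv hm hc
  have hne (i : ι) : ((m i + 1 : ℕ) : k) ≠ 0 := Nat.cast_ne_zero.2 (m i).succ_ne_zero
  have hpow : Tendsto (fun i => a ^ (m i + 1)) l (𝓝 1) := by
    have h := (hm.mul (hlim ha)).add_const 1
    rw [zero_mul, zero_add] at h
    refine h.congr fun i => ?_
    rw [mul_div_cancel₀ _ (hne i)]
    ring
  -- `((ab) ^ N - 1) / N = (a ^ N - 1) / N + a ^ N (b ^ N - 1) / N`, where `a ^ N → 1`.
  have h := (hlim ha).add (hpow.mul (hlim hb))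
  rw [one_mul] at h
  refine tendsto_nhds_unique (hlim hab) (h.congr fun i => ?_)
  rw [mul_pow, ← mul_div_assoc, ← add_div]
  congr 1
  ring

theorem log_sub_log [l.NeBot] (hinv : ∀ j : ℕ, ‖((j + 1 : ℕ) : k)‖⁻¹ ≤ j + 1)
    (hm : Tendsto (fun i => ((m i + 1 : ℕ) : k)) l (𝓝 0)) {a b : k}
    (hb : ‖b - 1‖ < 1) (hab : ‖a / b - 1‖ < 1) : log a - log b = log (a / b) := by
  have hb0 : b ≠ 0 := by
    rintro rfl
    simp at hb
  have h := log_mul hinv hm hab hb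
  rw [div_mul_cancel₀ _ hb0] at h
  rw [h, add_sub_cancel_right]

end FunctionalEquation

theorem norm_div_sub_one_eq [IsUltrametricDist k] {y z : k} (hz : ‖z‖ < 1) :
    ‖(1 + y) / (1 + z) - 1‖ = ‖y - z‖ := by
  have h1 : ‖1 + z‖ = 1 := by
    rw [IsUltrametricDist.norm_add_eq_max_of_norm_ne_norm (by rw [norm_one]; exact hz.ne'),
      norm_one, max_eq_left hz.le]
  have h0 : 1 + z ≠ 0 := by
    rw [← norm_ne_zero_iff, h1]
    exact one_ne_zero
  rw [div_sub_one h0, norm_div, h1, div_one]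
  congr 1
  ring

/-! ### Absolute values of integers -/

theorem InducesTrivial.norm_natCast (h : InducesTrivial k) (j : ℕ) : ‖((j + 1 : ℕ) : k)‖ = 1 := by
  have := h (j + 1 : ℕ) (Nat.cast_ne_zero.2 j.succ_ne_zero)
  rwa [Rat.cast_natCast] at this

section Padic

variable {p : ℕ}

theorem InducesPadic.norm_natCast (h : InducesPadic k p) (j : ℕ) :
    ‖((j + 1 : ℕ) : k)‖ = ((p : ℝ) ^ padicValNat p (j + 1))⁻¹ := by
  have h1 := h (j + 1 : ℕ)
  rw [Rat.cast_natCast, padicNorm.eq_zpow_of_nonzero (Nat.cast_ne_zero.2 j.succ_ne_zero),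
    padicValRat.of_nat, zpow_neg, zpow_natCast] at h1
  rw [h1]
  push_cast
  rfl

theorem InducesPadic.inv_norm_natCast_le (h : InducesPadic k p) (j : ℕ) :
    ‖((j + 1 : ℕ) : k)‖⁻¹ ≤ j + 1 := by
  rw [h.norm_natCast, inv_inv]
  exact_mod_cast Nat.le_of_dvd j.succ_pos pow_padicValNat_dvd

theorem InducesPadic.tendsto_natCast_pow (h : InducesPadic k p) (hp : p.Prime) :
    Tendsto (fun n : ℕ => ((p ^ n - 1 + 1 : ℕ) : k)) atTop (𝓝 0) := by
  have := Fact.mk hp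
  have hnorm : ‖(p : k)‖ < 1 := by
    have h1 := h (p : ℚ)
    rw [Rat.cast_natCast, padicNorm.padicNorm_p_of_prime] at h1
    rw [h1]
    push_cast
    exact inv_lt_one_of_one_lt₀ (by exact_mod_cast hp.one_lt)
  refine (tendsto_pow_atTop_nhds_zero_of_norm_lt_one hnorm).congr fun n => ?_
  rw [Nat.sub_add_cancel (Nat.one_le_pow _ _ hp.pos), Nat.cast_pow]

theorem radius_pos (hp : p.Prime) : 0 < radius p :=
  Real.rpow_pos_of_pos (by exact_mod_cast hp.pos) _

theorem radius_lt_one (hp : p.Prime) : radius p < 1 := by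
  have h1 : (1 : ℝ) < p := by exact_mod_cast hp.one_lt
  exact Real.rpow_lt_one_of_one_lt_of_neg h1 (div_neg_of_neg_of_pos (by norm_num) (by linarith))

/-- Bernoulli's inequality gives `1 + v (p - 1) ≤ p ^ v ≤ j + 1`, where `v` is the exponent of `p`
in `j + 1`. -/
theorem radius_pow_le (h : InducesPadic k p) (hp : p.Prime) (j : ℕ) :
    radius p ^ j ≤ ‖((j + 1 : ℕ) : k)‖ := by
  have h1 : (1 : ℝ) < p := by exact_mod_cast hp.one_lt
  have hp1 : (0 : ℝ) < p - 1 := by linarith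
  rw [h.norm_natCast, radius, ← Real.rpow_natCast, ← Real.rpow_mul (by linarith),
    ← Real.rpow_natCast, ← Real.rpow_neg (by linarith)]
  refine Real.rpow_le_rpow_of_exponent_le h1.le ?_
  have hb := one_add_mul_le_pow (a := (p : ℝ) - 1) (by linarith) (padicValNat p (j + 1))
  rw [add_sub_cancel] at hb
  have hle : (p : ℝ) ^ padicValNat p (j + 1) ≤ j + 1 := by
    exact_mod_cast Nat.le_of_dvd j.succ_pos pow_padicValNat_dvd
  have hv : (padicValNat p (j + 1) : ℝ) ≤ j / (p - 1) := by
    rw [le_div_iff₀ hp1]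
    linarith
  have he : -1 / ((p : ℝ) - 1) * j = -(j / (p - 1)) := by ring
  rw [he]
  exact neg_le_neg hv

end Padic

end UltrametricLog

theorem mainTheorem5 {k : Type*} [NormedField k] [IsUltrametricDist k] [CompleteSpace k]
    [CharZero k] :
    (UltrametricLog.InducesTrivial k →
      (∀ x : k, ‖x‖ < 1 →
        HasSum (fun j : ℕ => (-1 : k) ^ (j + 2) / ((j + 1 : ℕ) : k) * x ^ (j + 1))
          (UltrametricLog.log (1 + x))) ∧
      (∀ x : k, ‖x‖ < 1 → ‖UltrametricLog.log (1 + x)‖ = ‖x‖) ∧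
      (∀ y z : k, ‖y‖ < 1 → ‖z‖ < 1 →
        ‖UltrametricLog.log (1 + y) - UltrametricLog.log (1 + z)‖ = ‖y - z‖) ∧
      (∀ t : ℝ, 0 < t → t < 1 →
        (fun x : k => UltrametricLog.log (1 + x)) '' Metric.closedBall 0 t
          = Metric.closedBall 0 t) ∧
      (fun x : k => UltrametricLog.log (1 + x)) '' Metric.ball 0 1 = Metric.ball 0 1) ∧
    (∀ p : ℕ, p.Prime → UltrametricLog.InducesPadic k p →
      (∀ x : k, ‖x‖ < 1 →
        HasSum (fun j : ℕ => (-1 : k) ^ (j + 2) / ((j + 1 : ℕ) : k) * x ^ (j + 1))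
          (UltrametricLog.log (1 + x))) ∧
      (∀ x : k, ‖x‖ ≤ UltrametricLog.radius p → ‖UltrametricLog.log (1 + x)‖ ≤ ‖x‖) ∧
      (∀ y z : k, ‖y‖ < 1 → ‖z‖ < 1 →
        ‖(1 + y) / (1 + z) - 1‖ ≤ UltrametricLog.radius p →
        ‖UltrametricLog.log (1 + y) - UltrametricLog.log (1 + z)‖ ≤ ‖y - z‖) ∧
      (∀ y z : k, ‖y‖ ≤ UltrametricLog.radius p → ‖z‖ ≤ UltrametricLog.radius p →
        ‖UltrametricLog.log (1 + y) - UltrametricLog.log (1 + z)‖ ≤ ‖y - z‖) ∧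
      (∀ x : k, ‖x‖ < UltrametricLog.radius p → ‖UltrametricLog.log (1 + x)‖ = ‖x‖) ∧
      (∀ y z : k, ‖y‖ < 1 → ‖z‖ < 1 →
        ‖(1 + y) / (1 + z) - 1‖ < UltrametricLog.radius p →
        ‖UltrametricLog.log (1 + y) - UltrametricLog.log (1 + z)‖ = ‖y - z‖) ∧
      (∀ y z : k, ‖y‖ < UltrametricLog.radius p → ‖z‖ < UltrametricLog.radius p →
        ‖UltrametricLog.log (1 + y) - UltrametricLog.log (1 + z)‖ = ‖y - z‖) ∧
      (∀ t : ℝ, 0 < t → t < UltrametricLog.radius p →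
        (fun x : k => UltrametricLog.log (1 + x)) '' Metric.closedBall 0 t
          = Metric.closedBall 0 t) ∧
      (fun x : k => UltrametricLog.log (1 + x)) '' Metric.ball 0 (UltrametricLog.radius p)
        = Metric.ball 0 (UltrametricLog.radius p)) := by
  refine ⟨fun h => ?_, fun p hp h => ?_⟩
  · have hinv (j : ℕ) : ‖((j + 1 : ℕ) : k)‖⁻¹ ≤ j + 1 := by
      rw [h.norm_natCast, inv_one]
      linarith [j.cast_nonneg (α := ℝ)]
    have hpow (j : ℕ) : (1 : ℝ) ^ j ≤ ‖((j + 1 : ℕ) : k)‖ := by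
      rw [h.norm_natCast, one_pow]
    exact ⟨fun x hx => UltrametricLog.hasSum_log hinv hx,
      fun x hx => UltrametricLog.norm_log_eq hinv one_pos le_rfl hpow hx,
      fun y z hy hz => UltrametricLog.norm_log_sub_eq hinv one_pos le_rfl hpow hy hz,
      fun t ht ht1 => UltrametricLog.image_closedBall_log hinv one_pos le_rfl hpow ht.le ht1,
      UltrametricLog.image_ball_log hinv one_pos le_rfl hpow⟩
  · have hinv := h.inv_norm_natCast_le
    have hpow := UltrametricLog.radius_pow_le h hp
    have hr := UltrametricLog.radius_pos hp
    have hr1 := UltrametricLog.radius_lt_one hp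
    have hle {x : k} (hx : ‖x‖ ≤ UltrametricLog.radius p) :
        ‖UltrametricLog.log (1 + x)‖ ≤ ‖x‖ := by
      simpa using UltrametricLog.norm_log_sub_le hinv hr hpow hx (z := 0) (by simpa using hr.le)
        (hx.trans_lt hr1) (by simp)
    have hsub {y z : k} (hz : ‖z‖ < 1) (hyz : ‖(1 + y) / (1 + z) - 1‖ < 1) :
        UltrametricLog.log (1 + y) - UltrametricLog.log (1 + z)
          = UltrametricLog.log (1 + ((1 + y) / (1 + z) - 1)) := by
      rw [UltrametricLog.log_sub_log hinv (h.tendsto_natCast_pow hp) (by simpa using hz) hyz,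
        add_sub_cancel]
    refine ⟨fun x hx => UltrametricLog.hasSum_log hinv hx, fun x hx => hle hx,
      fun y z _ hz hyz => ?_,
      fun y z hy hz => UltrametricLog.norm_log_sub_le hinv hr hpow hy hz (hy.trans_lt hr1)
        (hz.trans_lt hr1),
      fun x hx => UltrametricLog.norm_log_eq hinv hr hr1.le hpow hx, fun y z _ hz hyz => ?_,
      fun y z hy hz => UltrametricLog.norm_log_sub_eq hinv hr hr1.le hpow hy hz,
      fun t ht htr => UltrametricLog.image_closedBall_log hinv hr hr1.le hpow ht.le htr,
      UltrametricLog.image_ball_log hinv hr hr1.le hpow⟩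
    · rw [hsub hz (hyz.trans_lt hr1)]
      exact (hle hyz).trans_eq (UltrametricLog.norm_div_sub_one_eq hz)
    · rw [hsub hz (hyz.trans hr1), UltrametricLog.norm_log_eq hinv hr hr1.le hpow hyz,
        UltrametricLog.norm_div_sub_one_eq hz]
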